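/- Let $I=[0,1]$. For a continuous map $F:X\to X$ on a compact metric space and $x\in X$, let the special $\alpha$-limit set $s\alpha(x)$ be the set of all accumulation points of backward orbits of $x$, i.e. the union, over all sequences $(x_n)_{n\ge 0}$ in $X$ with $x_0=x$ and $F(x_{n+1})=x_n$ for all $n$, of the set of limits of convergent subsequences of $(x_n)$. Call a subset $S$ of a Polish space $Y$ $\boldsymbol\Sigma^1_1$-complete if $S$ is analytic and for every analytic subset $B$ of a zero-dimensional Polish space $Z$ (one with a basis of clopen sets) there is a continuous map $r:Z\to Y$ with $r^{-1}(S)=B$. **Theorem.** There are a continuous surjective map $F:I^2\to I^2$ and a point $x_0\in I^2$ such that $s\alpha(x_0)\subset I^2$ is $\boldsymbol\Sigma^1_1$-complete, and not Borel. Moreover, $F$ can be taken to be a piecewise monotone triangular map (skew product), i.e. $F(x,y)=(f(x),g_x(y))$ where, for some subdivision $0=a_0<a_1<\dots<a_n=1$, the base map $f:I\to I$ is strictly increasing or strictly decreasing on each $[a_i,a_{i+1}]$, and every fibre map $g_x:I\to I$ is strictly increasing. -/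

import Mathlib

/-- The closed unit square `[0,1]²` (the topology of the plane restricted to the square is the
product topology). -/
abbrev UnitSquare : Type := unitInterval × unitInterval

/-- `u` is a backward orbit of the point `x` under `f`: `u 0 = x` and `f (u (n+1)) = u n`. -/
def IsBackwardOrbit {X : Type*} (f : X → X) (x : X) (u : ℕ → X) : Prop :=
  u 0 = x ∧ ∀ n, f (u (n + 1)) = u n

/-- The special `α`-limit set of `x` under `f`: the union, over all backward orbits of `x`, of the
set of accumulation points of the orbit (points of which every neighbourhood contains `u n` for
infinitely many `n`). -/
def specialAlphaLimit {X : Type*} [TopologicalSpace X] (f : X → X) (x : X) : Set X :=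
  {y | ∃ u : ℕ → X, IsBackwardOrbit f x u ∧ MapClusterPt y Filter.atTop u}

/-- A set is `Σ¹₁`-complete if it is analytic and every analytic subset of a zero-dimensional
Polish space (one with a basis of clopen sets) is its preimage under some continuous map. Every
Polish space has at most continuum many points, so the spaces in `Type` represent all of them. -/
def IsSigmaOneOneComplete {Y : Type*} [TopologicalSpace Y] (S : Set Y) : Prop :=
  MeasureTheory.AnalyticSet S ∧
    ∀ (X : Type) [TopologicalSpace X] [PolishSpace X],
      TopologicalSpace.IsTopologicalBasis {U : Set X | IsClopen U} →
      ∀ B : Set X, MeasureTheory.AnalyticSet B → ∃ r : X → Y, Continuous r ∧ r ⁻¹' S = B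

/-- A self-map of `[0,1]` is piecewise (strictly) monotone if there is a subdivision
`0 = a 0 < ⋯ < a n = 1` such that the map is strictly increasing or strictly decreasing on each
of the closed intervals `[a i, a (i+1)]`. -/
def IsPiecewiseMonotone (f : unitInterval → unitInterval) : Prop :=
  ∃ (n : ℕ) (a : Fin (n + 1) → unitInterval),
    StrictMono a ∧ a 0 = 0 ∧ a (Fin.last n) = 1 ∧
      ∀ i : Fin n, StrictMonoOn f (Set.Icc (a i.castSucc) (a i.succ)) ∨
        StrictAntiOn f (Set.Icc (a i.castSucc) (a i.succ))

/-- A self-map `F` of the square is a piecewise monotone triangular map (skew product) if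
`F (x, y) = (f x, g x y)` with piecewise monotone base map `f` and with all fibre maps `g x`
strictly increasing; thus the square is cut into finitely many vertical strips on each of which
`F` is strictly monotone in the base and in the fibres. -/
def IsPiecewiseMonotoneTriangular (F : UnitSquare → UnitSquare) : Prop :=
  ∃ (f : unitInterval → unitInterval) (g : unitInterval → unitInterval → unitInterval),
    (∀ x y, F (x, y) = (f x, g x y)) ∧ IsPiecewiseMonotone f ∧ ∀ x, StrictMono (g x)

open MeasureTheory Filter Topology Set

/-! The set `illFounded` of codes of trees with an infinite branch is analytic, complete and not
Borel. It suffices to reduce it continuously to a special α-limit set, since such sets are always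
analytic (`analyticSet_specialAlphaLimit`).

The base map sends three laps over `[0, 3/4]`, so the backward tree of `5/8` is the full ternary
tree of words; its points are isolated from one another, and it approaches the fixed point `0` along
long runs of the symbol `0`. In a suitable fibre coordinate the fibre maps are translations, whose
amounts at the tree points may be prescribed as long as they tend to `0`
(`exists_continuousMap_eq_of_tendsto_cofinite`). Hence any function `level` on words whose
increments tend to `0` occurs as the height over the tree.

A backward orbit is an infinite history of words, and its run lengths of zeros converge to some `b`
in the Baire space. Taking for `level` a Cesàro mean of `ψ` at the run lengths makes the increments
small and the height converge to `ψ b` along every orbit. Orbits with unbounded runs accumulate on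
the fibre over `0`, so this fibre of the α-limit set is a copy of the range of `ψ`
(`exists_specialAlphaLimit_fibre_eq`). Choosing this range to be an embedded copy of `illFounded`
gives the reduction. -/

instance polishSpace_cantorSpace : PolishSpace (ℕ → Bool) := by
  have : TopologicalSpace.IsCompletelyMetrizableSpace (ℕ → Bool) := inferInstance
  have : TopologicalSpace.SeparableSpace (ℕ → Bool) := inferInstance
  infer_instance

/-! ### A complete analytic set that is not Borel -/

/-- The finite sequence of the first `k` values of `b`. -/
def initialSegment (b : ℕ → ℕ) (k : ℕ) : List ℕ := List.ofFn fun i : Fin k => b i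

@[simp] lemma length_initialSegment (b : ℕ → ℕ) (k : ℕ) : (initialSegment b k).length = k := by
  simp [initialSegment]

lemma initialSegment_eq_iff {b c : ℕ → ℕ} {k : ℕ} :
    initialSegment b k = initialSegment c k ↔ ∀ i < k, b i = c i := by
  constructor
  · intro h i hi
    exact congrFun (List.ofFn_injective h) ⟨i, hi⟩
  · intro h
    exact congrArg List.ofFn (funext fun i : Fin k => h i i.2)

/-- The set of (codes of) sets of finite sequences that contain all initial segments of some
infinite sequence. -/
def illFounded : Set (ℕ → Bool) :=
  {T | ∃ b : ℕ → ℕ, ∀ k, T (Encodable.encode (initialSegment b k)) = true}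

lemma continuous_eval_initialSegment (k : ℕ) :
    Continuous fun p : (ℕ → Bool) × (ℕ → ℕ) => p.1 (Encodable.encode (initialSegment p.2 k)) := by
  have h : Continuous fun q : (ℕ → Bool) × (Fin k → ℕ) =>
      q.1 (Encodable.encode (List.ofFn q.2)) := by
    rw [continuous_prod_of_discrete_right]
    intro c
    exact continuous_apply (A := fun _ : ℕ => Bool) (Encodable.encode (List.ofFn c))
  exact h.comp (continuous_fst.prodMk
    (continuous_pi fun i : Fin k => (continuous_apply (i : ℕ)).comp continuous_snd))

lemma analyticSet_illFounded : AnalyticSet illFounded := by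
  have hc : IsClosed {p : (ℕ → Bool) × (ℕ → ℕ) |
      ∀ k, p.1 (Encodable.encode (initialSegment p.2 k)) = true} := by
    simp only [ofPred_forall]
    exact isClosed_iInter fun k => isClosed_eq (continuous_eval_initialSegment k) continuous_const
  have : illFounded = Prod.fst '' {p : (ℕ → Bool) × (ℕ → ℕ) |
      ∀ k, p.1 (Encodable.encode (initialSegment p.2 k)) = true} := by
    ext T
    simp [illFounded]
  rw [this]
  exact hc.analyticSet.image_of_continuous continuous_fst

lemma tendsto_of_initialSegment {b : ℕ → ℕ} {c : ℕ → ℕ → ℕ}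
    (h : ∀ k, initialSegment (c k) k = initialSegment b k) : Tendsto c atTop (𝓝 b) := by
  rw [tendsto_pi_nhds]
  intro i
  apply tendsto_const_nhds.congr'
  filter_upwards [eventually_gt_atTop i] with k hk
  exact (initialSegment_eq_iff.1 (h k) i hk).symm

/-- Every analytic set in a zero-dimensional space is a continuous preimage of `illFounded`. -/
theorem exists_continuous_preimage_illFounded {X : Type*} [TopologicalSpace X]
    [SecondCountableTopology X] [T2Space X]
    (hX : TopologicalSpace.IsTopologicalBasis {U : Set X | IsClopen U}) {B : Set X}
    (hB : AnalyticSet B) : ∃ r : X → ℕ → Bool, Continuous r ∧ r ⁻¹' illFounded = B := by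
  rw [AnalyticSet] at hB
  rcases hB with rfl | ⟨φ, hφ, rfl⟩
  · exact ⟨fun _ _ => false, continuous_const, by ext; simp [illFounded]⟩
  obtain ⟨s, hs, hsc, hsb⟩ := hX.exists_countable
  have hne : s.Nonempty := by
    obtain ⟨v, hv, -⟩ := hsb.exists_subset_of_mem_open (mem_univ (φ 0)) isOpen_univ
    exact ⟨v, hv⟩
  obtain ⟨V, rfl⟩ := hsc.exists_eq_range hne
  have hV : ∀ i, IsClopen (V i) := fun i => hs (mem_range_self i)
  -- A word survives at `z` if no basic set of index below its length separates `z` from the image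
  -- of its cylinder. Bounding the index by the length keeps the condition clopen.
  set P : List ℕ → Set X := fun l =>
    {z | ∀ i < l.length, (∃ b, initialSegment b l.length = l ∧ φ b ∈ V i) ∨ z ∉ V i} with hP
  have hPc : ∀ l, IsClopen (P l) := by
    intro l
    have : P l = ⋂ i ∈ Finset.range l.length,
        {z | (∃ b, initialSegment b l.length = l ∧ φ b ∈ V i) ∨ z ∉ V i} := by
      ext z; simp [hP]
    rw [this]
    refine isClopen_biInter_finset fun i _ => ?_
    by_cases h : ∃ b, initialSegment b l.length = l ∧ φ b ∈ V i
    · simpa [h] using isClopen_univ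
    · simp only [h, false_or]
      exact (hV i).compl
  set R : ℕ → Set X := fun n => {z | ∀ l : List ℕ, Encodable.encode l = n → z ∈ P l} with hR
  have hRP : ∀ l, R (Encodable.encode l) = P l := by
    intro l; ext z
    simp only [hR, mem_ofPred_eq, Encodable.encode_inj]
    exact ⟨fun h => h l rfl, fun h m hm => hm ▸ h⟩
  have hRc : ∀ n, IsClopen (R n) := by
    intro n
    by_cases h : ∃ l : List ℕ, Encodable.encode l = n
    · obtain ⟨l, rfl⟩ := h
      rw [hRP]; exact hPc l
    · have : R n = univ := by
        ext z; simp only [hR, mem_ofPred_eq, mem_univ, iff_true]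
        exact fun l hl => (h ⟨l, hl⟩).elim
      rw [this]; exact isClopen_univ
  refine ⟨fun z n => (R n).boolIndicator z,
    continuous_pi fun n => (continuous_boolIndicator_iff_isClopen _).2 (hRc n), ?_⟩
  ext z
  simp only [illFounded, mem_preimage, mem_ofPred_eq, ← mem_iff_boolIndicator, hRP]
  constructor
  · rintro ⟨b, hb⟩
    refine ⟨b, ?_⟩
    by_contra hne
    -- A clopen `V i` around `z` misses `φ b`, yet the images of the cylinders of `b` of length
    -- above `i` all meet it; as `V i` is closed, the limit `φ b` lies in it.
    obtain ⟨_, ⟨i, rfl⟩, hzi, hi⟩ := hsb.exists_subset_of_mem_open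
      (show z ∈ ({φ b}ᶜ : Set X) from fun h => hne h.symm) isOpen_compl_singleton
    have hsel : ∀ k, ∃ c, initialSegment c k = initialSegment b k ∧ (i < k → φ c ∈ V i) := by
      intro k
      by_cases hk : i < k
      · rcases hb k i (by simpa using hk) with ⟨c, hc, hc'⟩ | h
        · exact ⟨c, by simpa using hc, fun _ => hc'⟩
        · exact (h hzi).elim
      · exact ⟨b, rfl, fun h => (hk h).elim⟩
    choose c hc hc' using hsel
    have hlim := (hφ.tendsto b).comp (tendsto_of_initialSegment hc)
    have : φ b ∈ V i := (hV i).isClosed.mem_of_tendsto hlim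
      ((eventually_gt_atTop i).mono fun k hk => hc' k hk)
    exact hi this rfl
  · rintro ⟨b, rfl⟩
    refine ⟨b, fun k i _ => ?_⟩
    by_cases h : φ b ∈ V i
    · exact Or.inl ⟨b, by simp, h⟩
    · exact Or.inr h

/-- The set `illFounded` is not Borel. -/
theorem not_measurableSet_illFounded : ¬ MeasurableSet[borel (ℕ → Bool)] illFounded := by
  intro hm
  borelize (ℕ → Bool)
  have hbasis : TopologicalSpace.IsTopologicalBasis {U : Set (ℕ → Bool) | IsClopen U} :=
    isTopologicalBasis_isClopen
  let enc : (ℕ → ℕ) → (ℕ → ℕ) → ℕ → ℕ := fun a b k =>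
    Encodable.encode (initialSegment a k, initialSegment b k)
  let toN : (ℕ → Bool) → ℕ → ℕ := fun z i => (z i).toNat
  have toN_cont : Continuous toN :=
    continuous_pi fun i =>
      (continuous_of_discreteTopology (f := Bool.toNat)).comp (continuous_apply i)
  -- Diagonal set: each `z` also codes an analytic set, and `D` asks whether `z` belongs to the set
  -- it codes. A code of `Dᶜ` would be contradictory.
  let D : Set (ℕ → Bool) := {z | ∃ b, ∀ k, z (enc (toN z) b k) = true}
  have hDc : IsClosed {p : (ℕ → Bool) × (ℕ → ℕ) | ∀ k, p.1 (enc (toN p.1) p.2 k) = true} := by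
    simp only [ofPred_forall]
    refine isClosed_iInter fun k => isClosed_eq ?_ continuous_const
    have h : Continuous fun q : (ℕ → Bool) × ((Fin k → ℕ) × (Fin k → ℕ)) =>
        q.1 (Encodable.encode (List.ofFn q.2.1, List.ofFn q.2.2)) := by
      rw [continuous_prod_of_discrete_right]
      intro c
      exact continuous_apply (A := fun _ : ℕ => Bool)
        (Encodable.encode (List.ofFn c.1, List.ofFn c.2))
    exact h.comp (continuous_fst.prodMk
      ((continuous_pi fun i : Fin k =>
        (continuous_apply (i : ℕ)).comp (toN_cont.comp continuous_fst)).prodMk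
        (continuous_pi fun i : Fin k => (continuous_apply (i : ℕ)).comp continuous_snd)))
  have hDa : AnalyticSet D := by
    convert hDc.analyticSet.image_of_continuous continuous_fst
    ext T
    simp [D]
  obtain ⟨r, hr, hrD⟩ := exists_continuous_preimage_illFounded hbasis hDa
  have hDm : MeasurableSet D := hrD ▸ hr.measurable hm
  have hDca : AnalyticSet Dᶜ := hDm.compl.analyticSet
  suffices H : ∃ z₀ : ℕ → Bool, ∀ z, z ∈ Dᶜ ↔ ∃ b, ∀ k, z₀ (enc (toN z) b k) = true by
    obtain ⟨z₀, h⟩ := H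
    exact (not_iff_self (a := z₀ ∈ D)) (h z₀)
  rw [AnalyticSet] at hDca
  rcases hDca with h | ⟨φ, hφ, hφr⟩
  · exact ⟨fun _ => false, fun z => by simp [h]⟩
  -- The code is the tree of initial segments of the graph of `φ`; its branches lie on the graph by
  -- continuity.
  let R : Set ℕ := {n | ∃ b k, n = enc (toN (φ b)) b k}
  refine ⟨R.boolIndicator, fun z => ?_⟩
  simp only [← mem_iff_boolIndicator, ← hφr]
  constructor
  · rintro ⟨b, rfl⟩
    exact ⟨b, fun k => ⟨b, k, rfl⟩⟩
  · rintro ⟨b, hb⟩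
    have hsel : ∀ k, ∃ c, initialSegment (toN z) k = initialSegment (toN (φ c)) k ∧
        initialSegment c k = initialSegment b k := by
      intro k
      obtain ⟨c, j, h⟩ := hb k
      have h' := Encodable.encode_injective h
      rw [Prod.mk.injEq] at h'
      have hkj : k = j := by simpa using congrArg List.length h'.1
      subst hkj
      exact ⟨c, h'.1, h'.2.symm⟩
    choose c hc hc' using hsel
    refine ⟨b, ?_⟩
    have h1 : Tendsto (fun k => toN (φ (c k))) atTop (𝓝 (toN (φ b))) :=
      ((toN_cont.comp hφ).tendsto b).comp (tendsto_of_initialSegment hc')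
    have h2 : Tendsto (fun k => toN (φ (c k))) atTop (𝓝 (toN z)) :=
      tendsto_of_initialSegment fun k => (hc k).symm
    have h3 := tendsto_nhds_unique h1 h2
    funext i
    have toNat_inj : ∀ a b : Bool, a.toNat = b.toNat → a = b := by decide
    exact toNat_inj _ _ (congrFun h3 i)

/-! ### Analyticity of special α-limit sets -/

/-- The special `α`-limit sets of a continuous map are analytic. -/
theorem analyticSet_specialAlphaLimit {X : Type*} [TopologicalSpace X] [PolishSpace X]
    {f : X → X} (hf : Continuous f) (x : X) : AnalyticSet (specialAlphaLimit f x) := by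
  let := TopologicalSpace.upgradeIsCompletelyMetrizable X
  borelize ((ℕ → X) × X)
  have h1 : IsClosed {p : (ℕ → X) × X | IsBackwardOrbit f x p.1} := by
    simp only [IsBackwardOrbit, ofPred_and, ofPred_forall]
    refine (isClosed_eq ((continuous_apply 0).comp continuous_fst) continuous_const).inter
      (isClosed_iInter fun n => isClosed_eq
        (hf.comp ((continuous_apply (n + 1)).comp continuous_fst))
        ((continuous_apply n).comp continuous_fst))
  have h2 : MeasurableSet {p : (ℕ → X) × X | MapClusterPt p.2 atTop p.1} := by
    have : {p : (ℕ → X) × X | MapClusterPt p.2 atTop p.1} = ⋂ k : ℕ, ⋂ N : ℕ, ⋃ n ≥ N,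
        {p | dist (p.1 n) p.2 < 1 / ((k : ℝ) + 1)} := by
      ext p
      simp only [mem_ofPred_eq, mem_iInter, mem_iUnion,
        Metric.nhds_basis_ball_inv_nat_succ.mapClusterPt_iff_frequently, frequently_atTop,
        Metric.mem_ball, true_imp_iff, exists_prop]
    rw [this]
    refine .iInter fun k => .iInter fun N => .iUnion fun n => .iUnion fun _ => ?_
    exact (isOpen_lt (((continuous_apply n).comp continuous_fst).dist continuous_snd)
      continuous_const).measurableSet
  convert (h1.measurableSet.inter h2).analyticSet.image_of_continuous continuous_snd
  ext y
  simp [specialAlphaLimit]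

/-! ### Prescribing values on a discrete family -/

/-- Real values that tend to `0` can be prescribed arbitrarily along a discrete injective family of
points by a globally defined continuous function. -/
theorem exists_continuousMap_eq_of_tendsto_cofinite {X ι : Type*} [TopologicalSpace X]
    [NormalSpace X] [T1Space X] {x : ι → X} (hx : Function.Injective x)
    (hiso : ∀ i, ∃ V, IsOpen V ∧ x i ∈ V ∧ {j | x j ∈ V}.Finite) {τ : ι → ℝ}
    (hτ : Tendsto τ cofinite (𝓝 0)) : ∃ t : C(X, ℝ), ∀ i, t (x i) = τ i := by
  -- Extension by `0` is continuous on the closure: each `x i` is isolated there, and near any other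
  -- point only small values of `τ` occur. Tietze's theorem then applies.
  have hg : ContinuousOn (Function.extend x τ 0) (closure (range x)) := by
    intro p _
    by_cases hp : p ∈ range x
    · obtain ⟨i, rfl⟩ := hp
      obtain ⟨V, hVo, hiV, hVf⟩ := hiso i
      set W : Set X := V \ (x '' ({j | x j ∈ V} \ {i})) with hW
      have hWo : IsOpen W := hVo.sdiff ((hVf.sdiff).image x).isClosed
      have hiW : x i ∈ W := by
        refine ⟨hiV, ?_⟩
        rintro ⟨j, ⟨-, hj⟩, hji⟩
        exact hj (hx hji)
      have hsub : ∀ q ∈ closure (range x), q ∈ W → q = x i := by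
        intro q hq hqW
        by_contra hne
        obtain ⟨_, ⟨hqW', hne'⟩, ⟨j, rfl⟩⟩ := mem_closure_iff.1 hq (W \ {x i})
          (hWo.sdiff isClosed_singleton) ⟨hqW, hne⟩
        exact hqW'.2 ⟨j, ⟨hqW'.1, fun h => hne' (congrArg x h)⟩, rfl⟩
      apply tendsto_const_nhds.congr'
      filter_upwards [self_mem_nhdsWithin, mem_nhdsWithin_of_mem_nhds (hWo.mem_nhds hiW)] with q hq hqW
      rw [hsub q hq hqW]
    · rw [ContinuousWithinAt, Function.extend_apply' _ _ _ (by simpa using hp), Metric.tendsto_nhds]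
      intro ε hε
      have hfin : {j | ¬ dist (τ j) 0 < ε}.Finite := by
        simpa using (Metric.tendsto_nhds.1 hτ ε hε)
      filter_upwards [mem_nhdsWithin_of_mem_nhds ((hfin.image x).isClosed.isOpen_compl.mem_nhds
        (show p ∉ x '' _ from fun h => hp (image_subset_range _ _ h)))] with q hq
      by_cases hqr : ∃ j, x j = q
      · obtain ⟨j, rfl⟩ := hqr
        rw [hx.extend_apply]
        by_contra h
        exact hq ⟨j, h, rfl⟩
      · rw [Function.extend_apply' _ _ _ hqr]
        simpa using hε
  obtain ⟨t, ht⟩ := ContinuousMap.exists_restrict_eq isClosed_closure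
    (⟨_, continuousOn_iff_continuous_domRestrict.1 hg⟩ : C(closure (range x), ℝ))
  refine ⟨t, fun i => ?_⟩
  have h := DFunLike.congr_fun ht ⟨x i, subset_closure (mem_range_self i)⟩
  simpa [hx.extend_apply] using h

/-! ### The base map and its backward tree -/

/-- A piecewise linear function on `[0, 1]`: its laps `[0, 1/6]`, `[1/6, 1/3]`, `[1/3, 1/2]` are
each mapped onto `[0, 3/4]`, and `[1/2, 1]` is mapped onto `[3/4, 1]`. -/
noncomputable def zigzagReal (x : ℝ) : ℝ :=
  max (min (9 * x / 2) (3 / 2 - 9 * x / 2)) (min (9 * x / 2 - 3 / 2) (x / 2 + 1 / 2))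

lemma zigzagReal_of_le {x : ℝ} (h : x ≤ 1 / 6) : zigzagReal x = 9 * x / 2 := by
  rw [zigzagReal, min_eq_left (by linarith), max_eq_left ((min_le_left _ _).trans (by linarith))]

lemma zigzagReal_of_mem_middle {x : ℝ} (h : 1 / 6 ≤ x) (h' : x ≤ 1 / 3) :
    zigzagReal x = 3 / 2 - 9 * x / 2 := by
  rw [zigzagReal, min_eq_right (by linarith), max_eq_left ((min_le_left _ _).trans (by linarith))]

lemma zigzagReal_of_ge {x : ℝ} (h : 1 / 3 ≤ x) :
    zigzagReal x = min (9 * x / 2 - 3 / 2) (x / 2 + 1 / 2) := by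
  rw [zigzagReal, max_eq_right]
  exact (min_le_right _ _).trans (le_min (by linarith) (by linarith))

lemma zigzagReal_mem {x : ℝ} (hx : x ∈ Icc (0 : ℝ) 1) : zigzagReal x ∈ Icc (0 : ℝ) 1 := by
  obtain ⟨h0, h1⟩ := hx
  rcases le_total x (1 / 6) with h | h
  · rw [zigzagReal_of_le h]; constructor <;> linarith
  rcases le_total x (1 / 3) with h' | h'
  · rw [zigzagReal_of_mem_middle h h']; constructor <;> linarith
  · rw [zigzagReal_of_ge h']
    exact ⟨le_min (by linarith) (by linarith), (min_le_right _ _).trans (by linarith)⟩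

/-- The function `zigzagReal` as a self-map of the unit interval. -/
noncomputable def zigzag (x : unitInterval) : unitInterval := ⟨zigzagReal x, zigzagReal_mem x.2⟩

lemma continuous_zigzag : Continuous zigzag := by
  unfold zigzag zigzagReal
  fun_prop

lemma three_quarters_le_zigzagReal {x : ℝ} (h : 1 / 2 ≤ x) : 3 / 4 ≤ zigzagReal x := by
  rw [zigzagReal_of_ge (by linarith)]
  exact le_min (by linarith) (by linarith)

lemma three_quarters_le_iterate_zigzag {x : unitInterval} (h : 3 / 4 ≤ (x : ℝ)) (n : ℕ) :
    3 / 4 ≤ ((zigzag^[n] x : unitInterval) : ℝ) := by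
  induction n generalizing x with
  | zero => exact h
  | succ n ih => exact ih (three_quarters_le_zigzagReal (by linarith))

lemma isPiecewiseMonotone_zigzag : IsPiecewiseMonotone zigzag := by
  refine ⟨3, ![0, ⟨1 / 6, by norm_num, by norm_num⟩, ⟨1 / 3, by norm_num, by norm_num⟩, 1],
    ?_, rfl, rfl, ?_⟩
  · rw [Fin.strictMono_iff_lt_succ]
    intro i
    rw [← Subtype.coe_lt_coe]
    fin_cases i
    · change (0 : ℝ) < 1 / 6; norm_num
    · change (1 / 6 : ℝ) < 1 / 3; norm_num
    · change (1 / 3 : ℝ) < 1; norm_num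
  · intro i
    fin_cases i
    · left
      rintro ⟨x, hx⟩ ⟨-, hx'⟩ ⟨y, hy⟩ ⟨-, hy'⟩ hxy
      simp only [← Subtype.coe_lt_coe, zigzag] at hxy ⊢
      rw [zigzagReal_of_le hx', zigzagReal_of_le hy']
      linarith
    · right
      rintro ⟨x, hx⟩ ⟨hx₁, hx₂⟩ ⟨y, hy⟩ ⟨hy₁, hy₂⟩ hxy
      simp only [← Subtype.coe_lt_coe, zigzag] at hxy ⊢
      rw [zigzagReal_of_mem_middle hx₁ hx₂, zigzagReal_of_mem_middle hy₁ hy₂]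
      linarith
    · left
      rintro ⟨x, hx⟩ ⟨hx', -⟩ ⟨y, hy⟩ ⟨hy', -⟩ hxy
      simp only [← Subtype.coe_lt_coe, zigzag] at hxy ⊢
      rw [zigzagReal_of_ge hx', zigzagReal_of_ge hy']
      exact min_lt_min (by linarith) (by linarith)

/-- The inverses of the three laps of `zigzagReal` over `[0, 3/4]`. -/
noncomputable def zigzagBranch (i : Fin 3) (z : ℝ) : ℝ :=
  ![2 * z / 9, 1 / 3 - 2 * z / 9, 1 / 3 + 2 * z / 9] i

lemma zigzagBranch_mem {z : ℝ} (hz : z ∈ Ioo (0 : ℝ) (3 / 4)) (i : Fin 3) :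
    zigzagBranch i z ∈ Ioo (0 : ℝ) (1 / 2) := by
  obtain ⟨h0, h1⟩ := hz
  fin_cases i <;> simp [zigzagBranch] <;> constructor <;> linarith

lemma zigzagReal_zigzagBranch {z : ℝ} (hz : z ∈ Ioo (0 : ℝ) (3 / 4)) (i : Fin 3) :
    zigzagReal (zigzagBranch i z) = z := by
  obtain ⟨h0, h1⟩ := hz
  fin_cases i <;> simp only [zigzagBranch, Fin.zero_eta, Fin.mk_one, Fin.reduceFinMk,
    Matrix.cons_val]
  · rw [zigzagReal_of_le (by linarith)]; ring
  · rw [zigzagReal_of_mem_middle (by linarith) (by linarith)]; ring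
  · rw [zigzagReal_of_ge (by linarith), min_eq_left (by linarith)]; ring

lemma exists_eq_zigzagBranch {x : ℝ} (h : zigzagReal x < 3 / 4) :
    ∃ i, x = zigzagBranch i (zigzagReal x) := by
  rcases le_total x (1 / 6) with h1 | h1
  · refine ⟨0, ?_⟩
    simp only [zigzagBranch, zigzagReal_of_le h1, Matrix.cons_val]; ring
  rcases le_total x (1 / 3) with h2 | h2
  · refine ⟨1, ?_⟩
    simp only [zigzagBranch, zigzagReal_of_mem_middle h1 h2, Matrix.cons_val]; ring
  · refine ⟨2, ?_⟩
    have h3 : x < 1 / 2 := by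
      by_contra! h3
      exact absurd (three_quarters_le_zigzagReal h3) (not_le.2 h)
    simp only [zigzagBranch, zigzagReal_of_ge h2, Matrix.cons_val]
    rw [min_eq_left (by linarith)]; ring

lemma zigzagBranch_injective {z w : ℝ} (hz : z ∈ Ioo (0 : ℝ) (3 / 4))
    (hw : w ∈ Ioo (0 : ℝ) (3 / 4)) {i j : Fin 3} (h : zigzagBranch i z = zigzagBranch j w) :
    i = j ∧ z = w := by
  obtain ⟨h0, h1⟩ := hz
  obtain ⟨k0, k1⟩ := hw
  fin_cases i <;> fin_cases j <;> simp only [zigzagBranch, Fin.zero_eta, Fin.mk_one,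
    Fin.reduceFinMk, Matrix.cons_val] at h <;>
    first
    | exact ⟨rfl, by linarith⟩
    | exfalso; linarith

/-- The points of the backward tree of `5/8` under `zigzag`, labelled by the words of the lap
inverses that produce them (the one applied last comes first). -/
noncomputable def treePointReal : List (Fin 3) → ℝ
  | [] => 5 / 8
  | i :: s => zigzagBranch i (treePointReal s)

lemma treePointReal_mem (s : List (Fin 3)) : treePointReal s ∈ Ioo (0 : ℝ) (3 / 4) := by
  induction s with
  | nil => norm_num [treePointReal]
  | cons i s ih =>
    have := zigzagBranch_mem ih i
    exact ⟨this.1, this.2.trans (by norm_num)⟩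

lemma treePointReal_injective : Function.Injective treePointReal := by
  intro s
  induction s with
  | nil =>
    rintro (_ | ⟨j, t⟩) h
    · rfl
    · have := (zigzagBranch_mem (treePointReal_mem t) j).2
      simp only [treePointReal] at h
      linarith
  | cons i s ih =>
    rintro (_ | ⟨j, t⟩) h
    · have := (zigzagBranch_mem (treePointReal_mem s) i).2
      simp only [treePointReal] at h
      linarith
    · obtain ⟨rfl, h'⟩ := zigzagBranch_injective (treePointReal_mem s) (treePointReal_mem t) h
      rw [ih h']

/-- The points of the backward tree of `5/8` under `zigzag`, as points of the unit interval. -/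
noncomputable def treePoint (s : List (Fin 3)) : unitInterval :=
  ⟨treePointReal s, (treePointReal_mem s).1.le, (treePointReal_mem s).2.le.trans (by norm_num)⟩

lemma treePoint_injective : Function.Injective treePoint := fun _ _ h =>
  treePointReal_injective (congrArg Subtype.val h)

lemma zigzag_treePoint_cons (i : Fin 3) (s : List (Fin 3)) :
    zigzag (treePoint (i :: s)) = treePoint s :=
  Subtype.ext (zigzagReal_zigzagBranch (treePointReal_mem s) i)

lemma exists_eq_treePoint_cons {x : unitInterval} {s : List (Fin 3)}
    (h : zigzag x = treePoint s) : ∃ i, x = treePoint (i :: s) := by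
  have h' : zigzagReal x = treePointReal s := congrArg Subtype.val h
  obtain ⟨i, hi⟩ := exists_eq_zigzagBranch (h' ▸ (treePointReal_mem s).2)
  exact ⟨i, Subtype.ext (by rw [hi, h']; rfl)⟩

lemma iterate_zigzag_treePoint (s : List (Fin 3)) :
    zigzag^[s.length] (treePoint s) = treePoint [] := by
  induction s with
  | nil => rfl
  | cons i s ih => rw [List.length_cons, Function.iterate_succ_apply, zigzag_treePoint_cons, ih]

/-- The window `(1/2, 3/4)` contains only the root of the tree: after `n` steps deeper points are
still below `1/2`, and shallower ones have passed the root and stay above `3/4`. This separates the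
levels of the tree by open sets. -/
lemma length_eq_of_iterate_zigzag_mem {s : List (Fin 3)} {n : ℕ}
    (h : ((zigzag^[n] (treePoint s) : unitInterval) : ℝ) ∈ Ioo (1 / 2 : ℝ) (3 / 4)) :
    s.length = n := by
  induction s generalizing n with
  | nil =>
    cases n with
    | zero => rfl
    | succ n =>
      refine absurd (three_quarters_le_iterate_zigzag ?_ n) (not_le.2 h.2)
      exact three_quarters_le_zigzagReal (by norm_num [treePoint, treePointReal])
  | cons i s ih =>
    cases n with
    | zero => exact absurd (zigzagBranch_mem (treePointReal_mem s) i).2 (not_lt.2 h.1.le)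
    | succ n =>
      rw [Function.iterate_succ_apply, zigzag_treePoint_cons] at h
      rw [List.length_cons, ih h]

lemma exists_isOpen_finite_treePoint_mem (s : List (Fin 3)) :
    ∃ V, IsOpen V ∧ treePoint s ∈ V ∧ {t | treePoint t ∈ V}.Finite := by
  refine ⟨(fun x => ((zigzag^[s.length] x : unitInterval) : ℝ)) ⁻¹' Ioo (1 / 2) (3 / 4),
    isOpen_Ioo.preimage (continuous_subtype_val.comp (continuous_zigzag.iterate _)), ?_, ?_⟩
  · rw [mem_preimage, iterate_zigzag_treePoint]
    norm_num [treePoint, treePointReal]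
  · exact (List.finite_length_eq (Fin 3) s.length).subset fun t ht =>
      length_eq_of_iterate_zigzag_mem ht

/-! ### Fibre maps -/

/-- The homeomorphism `y ↦ y ^ exp t` of the unit interval. -/
noncomputable def powFibre (t : ℝ) (y : unitInterval) : unitInterval :=
  ⟨(y : ℝ) ^ Real.exp t, Real.rpow_nonneg y.2.1 _,
    Real.rpow_le_one y.2.1 y.2.2 (Real.exp_pos t).le⟩

lemma continuous_powFibre : Continuous fun p : ℝ × unitInterval => powFibre p.1 p.2 := by
  refine Continuous.subtype_mk ?_ _
  exact (continuous_subtype_val.comp continuous_snd).rpow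
    (Real.continuous_exp.comp continuous_fst) fun p => Or.inr (Real.exp_pos _)

lemma strictMono_powFibre (t : ℝ) : StrictMono (powFibre t) := fun y _ h =>
  Real.rpow_lt_rpow y.2.1 h (Real.exp_pos t)

lemma powFibre_add (t u : ℝ) (y : unitInterval) :
    powFibre t (powFibre u y) = powFibre (u + t) y := by
  apply Subtype.ext
  simp only [powFibre]
  rw [← Real.rpow_mul y.2.1, Real.exp_add]

lemma powFibre_zero (y : unitInterval) : powFibre 0 y = y := by
  apply Subtype.ext
  simp [powFibre]

/-- The point `exp (-exp a)` of the unit interval. -/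
noncomputable def expNegExp (a : ℝ) : unitInterval :=
  ⟨Real.exp (-Real.exp a), (Real.exp_pos _).le, Real.exp_le_one_iff.2 (by
    linarith [Real.exp_pos a])⟩

lemma continuous_expNegExp : Continuous expNegExp := by
  unfold expNegExp
  fun_prop

lemma expNegExp_injective : Function.Injective expNegExp := fun a b h => by
  have h' : Real.exp (-Real.exp a) = Real.exp (-Real.exp b) := congrArg Subtype.val h
  exact Real.exp_injective (neg_injective (Real.exp_injective h'))

/-- In the coordinate `a` the fibre map is translation by `t`, so heights over a backward orbit can
be prescribed through their differences. -/
lemma powFibre_expNegExp (t a : ℝ) : powFibre t (expNegExp a) = expNegExp (a + t) := by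
  apply Subtype.ext
  simp only [powFibre, expNegExp]
  rw [← Real.exp_mul, Real.exp_add, neg_mul]

lemma surjective_zigzag : Function.Surjective zigzag := by
  have h0 : zigzag 0 = 0 := Subtype.ext (by norm_num [zigzag, zigzagReal])
  have h1 : zigzag 1 = 1 := Subtype.ext (by norm_num [zigzag, zigzagReal])
  intro y
  obtain ⟨x, -, hx⟩ := intermediate_value_Icc (zero_le_one (α := unitInterval))
    continuous_zigzag.continuousOn (h0.symm ▸ h1.symm ▸ ⟨y.2.1, y.2.2⟩ : y ∈ Icc (zigzag 0) (zigzag 1))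
  exact ⟨x, hx⟩

/-! ### Run lengths along histories -/

/-- The number of nonzero symbols of a word. -/
def runCount : List (Fin 3) → ℕ
  | [] => 0
  | i :: s => if i = 0 then runCount s else runCount s + 1

/-- The number of zeros at the beginning of a word. -/
def currentRun : List (Fin 3) → ℕ
  | [] => 0
  | i :: s => if i = 0 then currentRun s + 1 else 0

/-- The lengths of the runs of zeros of a word, listed from its end and without the run at its
beginning (and followed by zeros). -/
def runLengths : List (Fin 3) → ℕ → ℕ
  | [] => 0
  | i :: s => if i = 0 then runLengths s
      else Function.update (runLengths s) (runCount s) (currentRun s)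

lemma runCount_le_cons (i : Fin 3) (s : List (Fin 3)) : runCount s ≤ runCount (i :: s) := by
  rw [runCount]; split_ifs <;> omega

lemma runCount_le_length (s : List (Fin 3)) : runCount s ≤ s.length := by
  induction s with
  | nil => rfl
  | cons i s ih => rw [runCount, List.length_cons]; split_ifs <;> omega

lemma runLengths_cons_apply (i : Fin 3) {s : List (Fin 3)} {j : ℕ}
    (h : j < runCount s ∨ runCount (i :: s) ≤ j) : runLengths (i :: s) j = runLengths s j := by
  rw [runLengths]
  rw [runCount] at h
  split_ifs with hi
  · rfl
  · rw [if_neg hi] at h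
    exact Function.update_of_ne (by omega) _ _

/-- The inverse of the first lap contracts towards `0` by the factor `2/9`. -/
lemma treePointReal_le_pow_currentRun (s : List (Fin 3)) :
    treePointReal s ≤ (2 / 9 : ℝ) ^ currentRun s := by
  induction s with
  | nil => norm_num [treePointReal, currentRun]
  | cons i s ih =>
    rw [currentRun]
    split_ifs with hi
    · subst hi
      have : treePointReal (0 :: s) = 2 * treePointReal s / 9 := rfl
      rw [this, pow_succ]
      linarith
    · have := (treePointReal_mem (i :: s)).2
      rw [pow_zero]; linarith

/-- A sequence of words each of which arises from the previous one by prepending a symbol. -/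
def IsHistory (s : ℕ → List (Fin 3)) : Prop :=
  s 0 = [] ∧ ∀ n, ∃ i, s (n + 1) = i :: s n

namespace IsHistory

variable {s : ℕ → List (Fin 3)}

lemma length_eq (hs : IsHistory s) (n : ℕ) : (s n).length = n := by
  induction n with
  | zero => simp [hs.1]
  | succ n ih => obtain ⟨i, hi⟩ := hs.2 n; simp [hi, ih]

lemma monotone_runCount (hs : IsHistory s) : Monotone fun n => runCount (s n) :=
  monotone_nat_of_le_succ fun n => by
    obtain ⟨i, hi⟩ := hs.2 n
    rw [hi]; exact runCount_le_cons i _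

lemma runLengths_eq_of_lt (hs : IsHistory s) {j N : ℕ} (h : j < runCount (s N)) {n : ℕ}
    (hn : N ≤ n) : runLengths (s n) j = runLengths (s N) j := by
  induction n, hn using Nat.le_induction with
  | base => rfl
  | succ n hn ih =>
    obtain ⟨i, hi⟩ := hs.2 n
    rw [hi, runLengths_cons_apply i (Or.inl (h.trans_le (hs.monotone_runCount hn))), ih]

/-- A coordinate is frozen once its run is completed, and keeps its initial value if that never
happens. Thus even histories ending in an infinite run of zeros have a limit. -/
lemma exists_tendsto_runLengths (hs : IsHistory s) :
    ∃ b, Tendsto (fun n => runLengths (s n)) atTop (𝓝 b) := by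
  have : ∀ j, ∃ v N, ∀ n ≥ N, runLengths (s n) j = v := by
    intro j
    by_cases h : ∃ N, j < runCount (s N)
    · obtain ⟨N, hN⟩ := h
      exact ⟨_, N, fun n hn => hs.runLengths_eq_of_lt hN hn⟩
    · push Not at h
      refine ⟨runLengths (s 0) j, 0, fun n _ => ?_⟩
      induction n with
      | zero => rfl
      | succ n ih =>
        obtain ⟨i, hi⟩ := hs.2 n
        rw [hi, runLengths_cons_apply i (Or.inr (hi ▸ h (n + 1))), ih (Nat.zero_le _)]
  choose b N hb using this
  refine ⟨b, tendsto_pi_nhds.2 fun j => tendsto_const_nhds.congr' ?_⟩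
  filter_upwards [eventually_ge_atTop (N j)] with n hn
  exact (hb j n hn).symm

end IsHistory

/-! ### Heights as Cesàro means -/

/-- The sum of the values of `ψ` at the run lengths of the proper suffixes of a word. -/
noncomputable def targetSum (ψ : (ℕ → ℕ) → ℝ) : List (Fin 3) → ℝ
  | [] => 0
  | _ :: s => targetSum ψ s + ψ (runLengths s)

/-- The average of the values of `ψ` at the run lengths of the proper suffixes of a word. -/
noncomputable def level (ψ : (ℕ → ℕ) → ℝ) (s : List (Fin 3)) : ℝ := targetSum ψ s / s.length

lemma targetSum_mem {ψ : (ℕ → ℕ) → ℝ} (hψ : ∀ b, ψ b ∈ Icc (0 : ℝ) 1) (s : List (Fin 3)) :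
    targetSum ψ s ∈ Icc (0 : ℝ) s.length := by
  induction s with
  | nil => simp [targetSum]
  | cons i s ih =>
    have := hψ (runLengths s)
    rw [targetSum, List.length_cons, Nat.cast_succ]
    exact ⟨add_nonneg ih.1 this.1, add_le_add ih.2 this.2⟩

lemma level_mem {ψ : (ℕ → ℕ) → ℝ} (hψ : ∀ b, ψ b ∈ Icc (0 : ℝ) 1) (s : List (Fin 3)) :
    level ψ s ∈ Icc (0 : ℝ) 1 := by
  have := targetSum_mem hψ s
  exact ⟨div_nonneg this.1 (Nat.cast_nonneg _), div_le_one_of_le₀ this.2 (Nat.cast_nonneg _)⟩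

lemma level_cons (ψ : (ℕ → ℕ) → ℝ) (i : Fin 3) (s : List (Fin 3)) :
    level ψ (i :: s) = level ψ s + (ψ (runLengths s) - level ψ s) / (s.length + 1) := by
  cases s with
  | nil => simp [level, targetSum]
  | cons j s =>
    simp only [level, targetSum, List.length_cons]
    push_cast
    have h1 : (s.length : ℝ) + 1 ≠ 0 := by positivity
    have h2 : (s.length : ℝ) + 1 + 1 ≠ 0 := by positivity
    field_simp
    ring

/-- Adding one term to a mean of numbers in `[0, 1]` changes it by at most one over the length, and
only finitely many words have bounded length. -/
lemma tendsto_level_sub {ψ : (ℕ → ℕ) → ℝ} (hψ : ∀ b, ψ b ∈ Icc (0 : ℝ) 1) :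
    Tendsto (fun s => level ψ s.tail - level ψ s) cofinite (𝓝 0) := by
  have hle : ∀ s : List (Fin 3), |level ψ s.tail - level ψ s| ≤ 1 / s.length := by
    rintro (_ | ⟨i, s⟩)
    · simp
    · have h1 := hψ (runLengths s)
      have h2 := level_mem hψ s
      rw [List.tail_cons, level_cons, sub_add_cancel_left, abs_neg, abs_div, List.length_cons,
        Nat.cast_succ, abs_of_pos (show (0 : ℝ) < s.length + 1 by positivity)]
      gcongr
      rw [abs_le]
      constructor <;> linarith [h1.1, h1.2, h2.1, h2.2]
  have hlen : Tendsto (fun s : List (Fin 3) => s.length) cofinite atTop := by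
    rw [tendsto_atTop]
    intro n
    have := List.finite_length_lt (Fin 3) n
    simpa [Filter.eventually_cofinite] using this
  refine squeeze_zero_norm hle ?_
  exact tendsto_one_div_atTop_nhds_zero_nat.comp hlen

lemma IsHistory.tendsto_level {s : ℕ → List (Fin 3)} (hs : IsHistory s) {ψ : (ℕ → ℕ) → ℝ}
    (hψ : Continuous ψ) {b : ℕ → ℕ} (hb : Tendsto (fun n => runLengths (s n)) atTop (𝓝 b)) :
    Tendsto (fun n => level ψ (s n)) atTop (𝓝 (ψ b)) := by
  have hsum : ∀ n, targetSum ψ (s n) = ∑ k ∈ Finset.range n, ψ (runLengths (s k)) := by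
    intro n
    induction n with
    | zero => simp [hs.1, targetSum]
    | succ n ih =>
      obtain ⟨i, hi⟩ := hs.2 n
      rw [hi, targetSum, ih, Finset.sum_range_succ]
  refine ((hψ.tendsto b).comp hb).cesaro.congr fun n => ?_
  rw [level, hsum, hs.length_eq, div_eq_inv_mul]
  rfl

/-! ### Histories with prescribed runs -/

/-- The history whose completed runs of zeros have the lengths `r 0, r 1, …`. -/
def historyOfRuns (r : ℕ → ℕ) : ℕ → List (Fin 3)
  | 0 => []
  | n + 1 => (if currentRun (historyOfRuns r n) < r (runCount (historyOfRuns r n)) then 0 else 1) ::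
      historyOfRuns r n

lemma isHistory_historyOfRuns (r : ℕ → ℕ) : IsHistory (historyOfRuns r) :=
  ⟨rfl, fun _ => ⟨_, rfl⟩⟩

/-- The bound on the unfinished run is carried along because it yields equality when that run is
closed. -/
lemma runLengths_historyOfRuns (r : ℕ → ℕ) (n : ℕ) :
    currentRun (historyOfRuns r n) ≤ r (runCount (historyOfRuns r n)) ∧
      ∀ j < runCount (historyOfRuns r n), runLengths (historyOfRuns r n) j = r j := by
  induction n with
  | zero => simp [historyOfRuns, currentRun, runCount]
  | succ n ih =>
    rw [historyOfRuns]
    split_ifs with h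
    · simp only [currentRun, runCount, runLengths, if_true]
      exact ⟨h, ih.2⟩
    · have h1 : (1 : Fin 3) ≠ 0 := by decide
      simp only [currentRun, runCount, runLengths, if_neg h1]
      refine ⟨Nat.zero_le _, fun j hj => ?_⟩
      rcases (Nat.lt_succ_iff.1 hj).lt_or_eq with hj | rfl
      · rw [Function.update_of_ne hj.ne, ih.2 j hj]
      · rw [Function.update_self]; omega

lemma exists_runCount_historyOfRuns (r : ℕ → ℕ) (k : ℕ) :
    ∃ n, runCount (historyOfRuns r n) = k ∧ currentRun (historyOfRuns r n) = r k := by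
  have hstep : ∀ k, (∃ n, runCount (historyOfRuns r n) = k ∧ currentRun (historyOfRuns r n) = 0) →
      ∀ m ≤ r k, ∃ n, runCount (historyOfRuns r n) = k ∧ currentRun (historyOfRuns r n) = m := by
    intro k h0 m
    induction m with
    | zero => exact fun _ => h0
    | succ m ih =>
      intro hm
      obtain ⟨n, hn, hn'⟩ := ih (by omega)
      refine ⟨n + 1, ?_⟩
      rw [historyOfRuns, if_pos (by rw [hn, hn']; omega)]
      simp [runCount, currentRun, hn, hn']
  refine hstep k ?_ (r k) le_rfl
  induction k with
  | zero => exact ⟨0, rfl, rfl⟩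
  | succ k ih =>
    obtain ⟨n, hn, hn'⟩ := hstep k ih (r k) le_rfl
    refine ⟨n + 1, ?_⟩
    rw [historyOfRuns, if_neg (by rw [hn, hn']; omega)]
    simp [runCount, currentRun, hn]

lemma tendsto_runLengths_historyOfRuns (r : ℕ → ℕ) :
    Tendsto (fun n => runLengths (historyOfRuns r n)) atTop (𝓝 r) := by
  refine tendsto_pi_nhds.2 fun j => tendsto_const_nhds.congr' ?_
  obtain ⟨N, hN, -⟩ := exists_runCount_historyOfRuns r (j + 1)
  filter_upwards [eventually_ge_atTop N] with n hn
  refine ((runLengths_historyOfRuns r n).2 j ?_).symm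
  have := (isHistory_historyOfRuns r).monotone_runCount hn
  simp only at this
  omega

/-! ### The skew product and the reduction -/

/-- The point of the square over `treePoint s` in the backward tree. -/
noncomputable def squareTreePoint (ψ : (ℕ → ℕ) → ℝ) (s : List (Fin 3)) : UnitSquare :=
  (treePoint s, expNegExp (level ψ s))

/-- Every nonempty set that is a continuous image of the Baire space can be realized, up to
`expNegExp`, in the fibre over `0` of the special `α`-limit set of a point under a piecewise
monotone triangular map. -/
theorem exists_specialAlphaLimit_fibre_eq {φ : (ℕ → ℕ) → ℝ} (hφ : Continuous φ)
    (hφI : ∀ b, φ b ∈ Icc (0 : ℝ) 1) :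
    ∃ (F : UnitSquare → UnitSquare) (x₀ : UnitSquare), Continuous F ∧ Function.Surjective F ∧
      IsPiecewiseMonotoneTriangular F ∧
      ∀ y, ((0 : unitInterval), y) ∈ specialAlphaLimit F x₀ ↔ ∃ b, y = expNegExp (φ b) := by
  -- Truncated subtraction of `k` is undone by adding `k`. So `ψ` has the range of `φ`, with each
  -- value attained at a sequence whose `k`-th term is at least `k`; such runs force accumulation
  -- over `0`.
  set ψ : (ℕ → ℕ) → ℝ := fun b => φ fun k => b k - k with hψ_def
  have hψ : Continuous ψ := hφ.comp (continuous_pi fun k =>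
    (continuous_of_discreteTopology (f := fun m : ℕ => m - k)).comp (continuous_apply k))
  have hψI : ∀ b, ψ b ∈ Icc (0 : ℝ) 1 := fun b => hφI _
  obtain ⟨t, ht⟩ := exists_continuousMap_eq_of_tendsto_cofinite treePoint_injective
    exists_isOpen_finite_treePoint_mem (tendsto_level_sub hψI)
  set F : UnitSquare → UnitSquare := fun p => (zigzag p.1, powFibre (t p.1) p.2) with hF
  have hFt : ∀ i s, F (squareTreePoint ψ (i :: s)) = squareTreePoint ψ s := by
    intro i s
    refine Prod.ext (zigzag_treePoint_cons i s) ?_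
    simp only [hF, squareTreePoint, ht, powFibre_expNegExp, List.tail_cons]
    congr 1
    ring
  have hFinv : ∀ p s, F p = squareTreePoint ψ s → ∃ i, p = squareTreePoint ψ (i :: s) := by
    rintro ⟨x, y⟩ s h
    obtain ⟨i, rfl⟩ := exists_eq_treePoint_cons (congrArg Prod.fst h)
    refine ⟨i, Prod.ext rfl ((strictMono_powFibre (t (treePoint (i :: s)))).injective ?_)⟩
    exact congrArg Prod.snd (h.trans (hFt i s).symm)
  refine ⟨F, squareTreePoint ψ [], ?_, ?_, ?_, ?_⟩
  · exact (continuous_zigzag.comp continuous_fst).prodMk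
      (continuous_powFibre.comp ((t.continuous.comp continuous_fst).prodMk continuous_snd))
  · rintro ⟨x, y⟩
    obtain ⟨x', rfl⟩ := surjective_zigzag x
    refine ⟨(x', powFibre (-t x') y), Prod.ext rfl ?_⟩
    simp only [hF, powFibre_add, neg_add_cancel, powFibre_zero]
  · exact ⟨zigzag, fun x => powFibre (t x), fun _ _ => rfl, isPiecewiseMonotone_zigzag,
      fun x => strictMono_powFibre _⟩
  intro y
  constructor
  · rintro ⟨u, ⟨hu0, hu⟩, hy⟩
    have hex : ∀ n, ∃ s, u n = squareTreePoint ψ s := by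
      intro n
      induction n with
      | zero => exact ⟨[], hu0⟩
      | succ n ih =>
        obtain ⟨s, hs⟩ := ih
        obtain ⟨i, hi⟩ := hFinv (u (n + 1)) s ((hu n).trans hs)
        exact ⟨_, hi⟩
    choose s hs using hex
    have hinj : Function.Injective (squareTreePoint ψ) := fun a b h =>
      treePoint_injective (congrArg Prod.fst h)
    have hist : IsHistory s := by
      refine ⟨hinj ((hs 0).symm.trans hu0), fun n => ?_⟩
      obtain ⟨i, hi⟩ := hFinv (u (n + 1)) (s n) ((hu n).trans (hs n))
      exact ⟨i, hinj ((hs (n + 1)).symm.trans hi)⟩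
    obtain ⟨b, hb⟩ := hist.exists_tendsto_runLengths
    refine ⟨fun k => b k - k, ?_⟩
    have hlim : Tendsto (fun n => (u n).2) atTop (𝓝 (expNegExp (ψ b))) := by
      simp only [hs]
      exact (continuous_expNegExp.tendsto _).comp (hist.tendsto_level hψ hb)
    -- The heights converge along the whole orbit, so `y` can only be their limit.
    have hy' : MapClusterPt y atTop fun n => (u n).2 :=
      hy.continuousAt_comp continuous_snd.continuousAt
    rw [MapClusterPt, ClusterPt] at hy'
    exact tendsto_nhds_unique' (f := id) hy' inf_le_left (inf_le_right.trans hlim)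
  · rintro ⟨b, rfl⟩
    set r : ℕ → ℕ := fun k => b k + k with hr
    have hrb : ψ r = φ b := by simp [hψ_def, hr]
    refine ⟨fun n => squareTreePoint ψ (historyOfRuns r n), ⟨rfl, fun n => hFt _ _⟩, ?_⟩
    -- At time `n k` the unfinished run has reached its full length `r k ≥ k`, so the base point is
    -- at most `(2/9) ^ k`.
    choose n hn hn' using exists_runCount_historyOfRuns r
    have hntop : Tendsto n atTop atTop := by
      refine tendsto_atTop_mono (fun k => ?_) tendsto_id
      have := runCount_le_length (historyOfRuns r (n k))
      rwa [hn, (isHistory_historyOfRuns r).length_eq] at this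
    refine MapClusterPt.of_comp hntop (Tendsto.mapClusterPt ?_)
    refine Tendsto.prodMk_nhds ?_ ?_
    · rw [tendsto_subtype_rng]
      refine squeeze_zero (fun k => (treePointReal_mem _).1.le) (fun k => ?_)
        (tendsto_pow_atTop_nhds_zero_of_lt_one (show (0 : ℝ) ≤ 2 / 9 by norm_num) (by norm_num))
      refine (treePointReal_le_pow_currentRun _).trans ?_
      rw [hn']
      exact pow_le_pow_of_le_one (by norm_num) (by norm_num) (Nat.le_add_left _ _)
    · rw [← hrb]
      exact ((continuous_expNegExp.tendsto _).comp ((isHistory_historyOfRuns r).tendsto_level hψ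
        (tendsto_runLengths_historyOfRuns r))).comp hntop

lemma exists_continuous_injective_cantorSpace :
    ∃ e : (ℕ → Bool) → ℝ, Continuous e ∧ Function.Injective e ∧ ∀ z, e z ∈ Icc (0 : ℝ) 1 := by
  obtain ⟨e, he, hc, hi⟩ := (isClosed_Icc (a := (0 : ℝ)) (b := 1))
    |>.exists_nat_bool_injection_of_not_countable (by
      rw [Cardinal.Real.Icc_countable_iff]; norm_num)
  exact ⟨e, hc, hi, fun z => he (mem_range_self z)⟩

theorem theorem4p1 :
    ∃ (F : UnitSquare → UnitSquare) (x₀ : UnitSquare),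
      Continuous F ∧ Function.Surjective F ∧ IsPiecewiseMonotoneTriangular F ∧
        IsSigmaOneOneComplete (specialAlphaLimit F x₀) ∧
        ¬ @MeasurableSet UnitSquare (borel UnitSquare) (specialAlphaLimit F x₀) := by
  obtain ⟨e, hec, hei, heI⟩ := exists_continuous_injective_cantorSpace
  have hA := analyticSet_illFounded
  rw [AnalyticSet] at hA
  rcases hA with hA | ⟨φ, hφ, hφr⟩
  · exact absurd (hA ▸ @MeasurableSet.empty _ (borel _)) not_measurableSet_illFounded
  obtain ⟨F, x₀, hFc, hFs, hFm, hF⟩ := exists_specialAlphaLimit_fibre_eq (hec.comp hφ)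
    fun b => heI _
  set q : (ℕ → Bool) → UnitSquare := fun T => (0, expNegExp (e T)) with hq
  have hqc : Continuous q := continuous_const.prodMk (continuous_expNegExp.comp hec)
  have hqA : q ⁻¹' specialAlphaLimit F x₀ = illFounded := by
    ext T
    rw [mem_preimage, hq, hF, ← hφr]
    constructor
    · rintro ⟨b, hb⟩
      exact ⟨b, (hei (expNegExp_injective hb)).symm⟩
    · rintro ⟨b, rfl⟩
      exact ⟨b, rfl⟩
  refine ⟨F, x₀, hFc, hFs, hFm, ⟨analyticSet_specialAlphaLimit hFc x₀, ?_⟩, ?_⟩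
  · intro X _ _ hX B hB
    obtain ⟨r, hr, hrB⟩ := exists_continuous_preimage_illFounded hX hB
    exact ⟨q ∘ r, hqc.comp hr, by rw [preimage_comp, hqA, hrB]⟩
  · intro hm
    borelize UnitSquare (ℕ → Bool)
    apply not_measurableSet_illFounded
    rw [← hqA, ← BorelSpace.measurable_eq (α := ℕ → Bool)]
    exact hqc.measurable hm
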